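/- **Setting.** Let $\mathcal E$ be a countable percept space and $\mathcal A$ a finite action space with $A=|\mathcal A|\ge 2$. Histories are the finite sequences $h=e_1a_1e_2\dots a_{n-1}e_n$, $n=|h|\ge1$; $\mathcal H_n$ is the set of histories with $n$ percepts and $\mathcal H=\bigcup_n\mathcal H_n$. An environment consists of an initial percept distribution, a transition function $\mu(\cdot\,|\,ha)$ that gives a distribution on $\mathcal E$ for every history $h$ and action $a$, and a reward function that gives for every history a distribution on $[0,1]$. For a (history-dependent, stochastic) policy $\pi$ and $\gamma\in(0,1)$ let $V^\pi(h)=\mathbb E^\pi[\sum_{m\ge1}\gamma^{m-1}r_{|h|+m}\mid h]$ and $V^*(h)=\sup_\pi V^\pi(h)$; $\pi$ is $\delta$-optimal if $|V^*(h)-V^\pi(h)|\le\delta$ for all $h\in\mathcal H$. Let $r_\mu(ha)$ be the expected reward received after taking $a$ at $h$. **Surrogate MDPs.** An abstraction is a map $\psi$ from $\mathcal H$ onto a finite set $\mathcal S$ of $S$ states. A surrogate MDP of $\psi$ is the MDP on $\mathcal S$ with $$\bar\mu(s'|sa)=\sum_{m\ge1} w_m(sa)\sum_{h\in\mathcal H_m}B_m(h|sa)\sum_{e':\psi(hae')=s'}\mu(e'|ha),\qquad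 \bar r(sa)=\sum_{m\ge1} w_m(sa)\sum_{h\in\mathcal H_m}B_m(h|sa)\,r_\mu(ha),$$ for any weights $w_m(sa)\ge0$ with $\sum_m w_m(sa)=1$ and any probability distributions $B_m(\cdot|sa)$ supported on $\{h\in\mathcal H_m:\psi(h)=s\}$ (for those $m$ with $w_m(sa)>0$). **Binarization.** Let $d=\lceil\log_2A\rceil$, and fix an encoding of actions by words of $d$ bits together with a decoding of all words of $d$ bits to actions that inverts it. The binarized environment has action space $\{0,1\}$: it collects $d$ bits, answering each of the first $d-1$ bits with an arbitrary fixed placeholder percept (which may depend on the past) and reward $0$; on the last bit it executes the decoded action in the original environment and passes on the resulting percept and reward. Its discount factor is $\lambda=\gamma^{1/d}$. A policy of a surrogate MDP of an abstraction $\psi$ of the binarized environment is used in the original environment as follows: at a history $h$, pass to the corresponding (encoded) binarized history, choose $d$ bits in turn, each according to the policy at the $\psi$-state of the current binarized history, and take the decoded action. **Theorem.** For every environment, every $\gamma\in(0,1)$ and every $\varepsilon>0$, there is an abstraction of the binarized environment such that any optimal policy (for the discount factor $\lambda$) of any of its surrogate MDPs is $\frac{\varepsilon}{1-\gamma}$-optimal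 in the original environment, and its number of states satisfies, uniformly over all environments, $$S\le\max\Big\{1,\ \frac{16\,(\lceil\log_2A\rceil+1-\gamma)^3}{\gamma\,\varepsilon\,(1-\gamma)^2}\Big\}.$$ If $\gamma\ge0.99$, then also $$S\le\max\big\{1,\ 17\,\lceil\log_2A\rceil^3\,\varepsilon^{-1}(1-\gamma)^{-2}\big\}.$$ There is a universal constant $A_0$ such that this simplified bound holds already for $\gamma\ge0.95$ whenever $A\ge A_0$. (For $\varepsilon\le1$ each maximum is attained by its second term.) -/

import Mathlib

open MeasureTheory

noncomputable section

/-- Expectation of a real function under a (countably supported) distribution. -/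
def expect {α : Type*} (p : PMF α) (f : α → ℝ) : ℝ := ∑' x, (p x).toReal * f x

/-! ## General reinforcement learning -/

/-- Finite interaction histories `e₁ a₁ e₂ a₂ … aₙ₋₁ eₙ`, `n ≥ 1`, with percepts in `E` and actions
in `A`. -/
inductive History (E : Type*) (A : Type*) where
  | init (e : E) : History E A
  | step (h : History E A) (a : A) (e : E) : History E A

/-- The time-step `n` of a history, i.e. its number of percepts. -/
def History.length {E A : Type*} : History E A → ℕ
  | .init _ => 1
  | .step h _ _ => h.length + 1

/-- A history-dependent, possibly stochastic policy. -/
abbrev Policy (E A : Type*) := History E A → PMF A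

/-- A history-based environment with random rewards in `[0, 1]`. -/
structure Environment (E A : Type*) where
  /-- distribution of the first percept -/
  initial : PMF E
  /-- distribution of the next percept, given a history and an action -/
  trans : History E A → A → PMF E
  /-- distribution of the reward received on arrival at a history -/
  reward : History E A → ProbabilityMeasure (Set.Icc (0 : ℝ) 1)

namespace Environment

variable {E A : Type*}

/-- Mean of the reward received on arrival at a history. -/
def meanReward (env : Environment E A) (h : History E A) : ℝ :=
  ∫ x, (x : ℝ) ∂(env.reward h : Measure (Set.Icc (0 : ℝ) 1))

/-- `r_μ(ha)`: expected reward received after taking action `a` at history `h`. -/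
def actionReward (env : Environment E A) (h : History E A) (a : A) : ℝ :=
  expect (env.trans h a) fun e => env.meanReward (h.step a e)

/-- Law of the history `m` time-steps after `h`, when the agent follows `π`. -/
def historyLaw (env : Environment E A) (π : Policy E A) (h : History E A) :
    ℕ → PMF (History E A)
  | 0 => PMF.pure h
  | m + 1 => (env.historyLaw π h m).bind fun h' =>
      (π h').bind fun a => (env.trans h' a).map fun e => h'.step a e

/-- `V^π(h) = E^π[∑_{m ≥ 1} γ^{m-1} r_{|h|+m} | h]` (the index `m` below is the `m - 1` here). -/
def value (env : Environment E A) (γ : ℝ) (π : Policy E A) (h : History E A) : ℝ :=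
  ∑' m : ℕ, γ ^ m * expect (env.historyLaw π h (m + 1)) env.meanReward

/-- `V^*(h)`: the supremum of `V^π(h)` over all policies. -/
def optValue (env : Environment E A) (γ : ℝ) (h : History E A) : ℝ :=
  ⨆ π : Policy E A, env.value γ π h

/-- `π` is `δ`-optimal: `|V^*(h) - V^π(h)| ≤ δ` at every history. -/
def IsNearOptimal (env : Environment E A) (γ δ : ℝ) (π : Policy E A) : Prop :=
  ∀ h, |env.optValue γ h - env.value γ π h| ≤ δ

end Environment

/-! ## Markov decision processes -/

/-- A Markov decision process. -/
structure MDP (S A : Type*) where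
  trans : S → A → PMF S
  reward : S → A → ℝ

namespace MDP

variable {S A : Type*}

/-- Law of the state after `n` steps from `s` under the policy `π`. -/
def stateLaw (M : MDP S A) (π : S → PMF A) (s : S) : ℕ → PMF S
  | 0 => PMF.pure s
  | n + 1 => (M.stateLaw π s n).bind fun s' => (π s').bind fun a => M.trans s' a

/-- Expected discounted sum of rewards from state `s` under the policy `π`. -/
def value (M : MDP S A) (γ : ℝ) (π : S → PMF A) (s : S) : ℝ :=
  ∑' n : ℕ, γ ^ n * expect (M.stateLaw π s n) fun s' => expect (π s') (M.reward s')

/-- `π` is an optimal policy of the MDP with discount factor `γ`. -/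
def IsOptimal (M : MDP S A) (γ : ℝ) (π : S → PMF A) : Prop :=
  ∀ (π' : S → PMF A) (s : S), M.value γ π' s ≤ M.value γ π s

end MDP

/-! ## Surrogate MDPs of an abstraction -/

/-- The data `{w_n, B_n}` that determine a surrogate MDP of the abstraction `ψ`: weights `w_n(sa)`
summing to one over the time-steps, and distributions `B_n(· | sa)` on the histories of length `n`
that `ψ` maps to `s`. Only the `B_n(· | sa)` of positive weight are constrained, since there may be
no history of length `n` in the state `s`. -/
structure Dispersion {E A S : Type*} (ψ : History E A → S) where
  w : S → A → PMF ℕ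
  B : ℕ → S → A → PMF (History E A)
  support_B : ∀ n s a h, w s a n ≠ 0 → B n s a h ≠ 0 → h.length = n ∧ ψ h = s

/-- The surrogate MDP: `μ̄(s'|sa) = ∑_m w_m(sa) ∑_h μ_ψ(s'|ha) B_m(h|sa)`, where `μ_ψ(·|ha)` is the
image of `μ(·|ha)` under `e' ↦ ψ(hae')`, and `r̄(sa) = ∑_m w_m(sa) ∑_h r_μ(ha) B_m(h|sa)`. -/
def surrogate {E A S : Type*} (env : Environment E A) (ψ : History E A → S)
    (D : Dispersion ψ) : MDP S A where
  trans s a := (D.w s a).bind fun m => (D.B m s a).bind fun h =>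
    (env.trans h a).map fun e => ψ (h.step a e)
  reward s a := expect (D.w s a) fun m => expect (D.B m s a) fun h => env.actionReward h a

/-! ## Binarization -/

/-- A code that represents the actions by `d` bits. Every word of `d` bits is decoded to some
action (the values of `dec` on words of other lengths are never used). -/
structure BinaryCode (A : Type*) (d : ℕ) where
  enc : A → List Bool
  dec : List Bool → A
  length_enc : ∀ a, (enc a).length = d
  dec_enc : ∀ a, dec (enc a) = a

namespace BinaryCode

variable {E A : Type*} {d : ℕ}

/-- The original history that underlies a history of the binarized environment, with the bits of the
current, still incomplete, action. The percepts shown in between are ignored. -/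
def decode (c : BinaryCode A d) : History E Bool → History E A × List Bool
  | .init e => (.init e, [])
  | .step h x e =>
      let p := c.decode h
      if p.2.length + 1 = d then (p.1.step (c.dec (p.2 ++ [x])) e, [])
      else (p.1, p.2 ++ [x])

/-- The binarized environment. It collects the bits of an action, answering each bit `x` at `h` but
the last of the action with the placeholder percept `filler h x` and the reward `0`; on the last bit
it executes the action and passes on the percept and the reward of the original environment. -/
def binarize (c : BinaryCode A d) (filler : History E Bool → Bool → E) (env : Environment E A) :
    Environment E Bool where
  initial := env.initial
  trans h x :=
    let p := c.decode h
    if p.2.length + 1 = d then env.trans p.1 (c.dec (p.2 ++ [x])) else PMF.pure (filler h x)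
  reward h :=
    let p := c.decode h
    if p.2 = [] then env.reward p.1
    else ⟨Measure.dirac ⟨0, by norm_num⟩, Measure.dirac.isProbabilityMeasure⟩

/-- Extend a binarized history by the given bits, with placeholder percepts in between and the
percept `e` after the last bit. -/
def appendBits (filler : History E Bool → Bool → E) :
    History E Bool → List Bool → E → History E Bool
  | h, [], _ => h
  | h, [x], e => h.step x e
  | h, x :: y :: xs, e => appendBits filler (h.step x (filler h x)) (y :: xs) e

/-- The history of the binarized environment that corresponds to an original history. -/
def encode (c : BinaryCode A d) (filler : History E Bool → Bool → E) :
    History E A → History E Bool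
  | .init e => .init e
  | .step h a e => appendBits filler (c.encode filler h) (c.enc a) e

/-- Distribution of the next `n` bits chosen by `π` from the binarized history `h` on, while
placeholder percepts are shown. -/
def sampleBits (filler : History E Bool → Bool → E) (π : Policy E Bool) :
    History E Bool → ℕ → PMF (List Bool)
  | _, 0 => PMF.pure []
  | h, n + 1 => (π h).bind fun x =>
      (sampleBits filler π (h.step x (filler h x)) n).map fun xs => x :: xs

/-- The policy in the original environment that a policy for the binarized environment describes:
at `h`, choose `d` bits in turn and take the action which they encode. -/
def liftPolicy (c : BinaryCode A d) (filler : History E Bool → Bool → E) (π : Policy E Bool) :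
    Policy E A :=
  fun h => (sampleBits filler π (c.encode filler h) d).map c.dec

end BinaryCode

end

/-!
The abstraction is built from the optimal value of the binarized environment, and only one quantity
per history has to be discretized because there are two actions.

Regard histories as the states of a Markov decision process. The Bellman optimality operator is a
contraction, so the original environment has a Bellman solution `W`, which dominates the value of
every policy; backing `W` up through the incomplete words of bits (`bestCompletion`) yields the
Bellman solution `U` of the binarized environment (`isBellman_maxBitValue`). As all rewards are
postponed to the last bit, `U` still lies between `0` and `1 / (1 - γ)`, although `λ > γ`.

Binarized histories are classified by the cell of `U` in a grid of mesh `δ`, by an optimal bit, and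
by whether the other bit is `τ`-optimal. Two facts make this work.

* In a surrogate, the action value at `s` is an average over the class `s`. The optimal bit is
  common to the class, so the optimal value of the surrogate satisfies the Bellman equation of `U`
  up to `δ`, and lies within `δ / (1 - λ)` of `U`. Hence a bit that loses more than `τ` throughout
  its class looks worse than the optimal bit as soon as `2 δ / (1 - λ) < τ`, and an optimal policy
  of the surrogate never takes it (`le_qValue_of_isOptimal_surrogate`). A bit that loses at most
  `τ` throughout its class is harmless, whatever the surrogate makes of it.
* Choosing `d` bits, each with loss at most `τ`, gives an action with loss at most `d τ / γ`
  (`sub_le_expect_liftPolicy`), and a loss of at most `ε` per action adds up to `ε / (1 - γ)`.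

With `τ = ε γ / d`, and since `1 - γ ≤ d (1 - λ)`, a mesh slightly below `τ (1 - γ) / (2 d)` is fine
enough. There are about `1 / ((1 - γ) δ)` cells, hence at most `10 d² / (γ ε (1 - γ)²) + 4` states.
For `ε < 1` this is below both bounds, the second one for all `γ ≥ 0.95` and every number of
actions; for `ε ≥ 1` every policy is good enough and one state suffices.

Sums over trajectories are treated by one telescoping identity, `value_eq_add_tsum`, that compares
the value of a policy with an arbitrary bounded function.
-/

noncomputable section

/-! ### Expectations of bounded functions -/

section Expect

variable {α β : Type*}

theorem PMF.summable_toReal (p : PMF α) : Summable fun x => (p x).toReal :=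
  ENNReal.summable_toReal p.tsum_coe_ne_top

theorem PMF.tsum_toReal (p : PMF α) : ∑' x, (p x).toReal = 1 := by
  rw [← ENNReal.tsum_toReal_eq fun x => p.apply_ne_top x, p.tsum_coe, ENNReal.toReal_one]

/-- A real function that is bounded in absolute value. -/
def IsBddFun (f : α → ℝ) : Prop := ∃ C, ∀ x, |f x| ≤ C

theorem isBddFun_of_mem_Icc {f : α → ℝ} {a b : ℝ} (hf : ∀ x, f x ∈ Set.Icc a b) : IsBddFun f :=
  ⟨max |a| |b|, fun x => abs_le_max_abs_abs (hf x).1 (hf x).2⟩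

theorem IsBddFun.comp {f : α → ℝ} (hf : IsBddFun f) (g : β → α) : IsBddFun fun x => f (g x) :=
  hf.imp fun _ hC x => hC (g x)

theorem isBddFun_const (c : ℝ) : IsBddFun fun _ : α => c := ⟨|c|, fun _ => le_rfl⟩

theorem IsBddFun.const_mul {f : α → ℝ} (hf : IsBddFun f) (c : ℝ) : IsBddFun fun x => c * f x := by
  obtain ⟨C, hC⟩ := hf
  exact ⟨|c| * C, fun x => by rw [abs_mul]; exact mul_le_mul_of_nonneg_left (hC x) (abs_nonneg c)⟩

theorem IsBddFun.add {f g : α → ℝ} (hf : IsBddFun f) (hg : IsBddFun g) :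
    IsBddFun fun x => f x + g x := by
  obtain ⟨C, hC⟩ := hf
  obtain ⟨D, hD⟩ := hg
  exact ⟨C + D, fun x => (abs_add_le _ _).trans (add_le_add (hC x) (hD x))⟩

theorem IsBddFun.sub {f g : α → ℝ} (hf : IsBddFun f) (hg : IsBddFun g) :
    IsBddFun fun x => f x - g x := by
  obtain ⟨C, hC⟩ := hf
  obtain ⟨D, hD⟩ := hg
  exact ⟨C + D, fun x => (abs_sub _ _).trans (add_le_add (hC x) (hD x))⟩

theorem IsBddFun.summable {f : α → ℝ} (hf : IsBddFun f) (p : PMF α) :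
    Summable fun x => (p x).toReal * f x := by
  obtain ⟨C, hC⟩ := hf
  refine Summable.of_norm_bounded (p.summable_toReal.mul_right C) fun x => ?_
  rw [Real.norm_eq_abs, abs_mul, abs_of_nonneg ENNReal.toReal_nonneg]
  exact mul_le_mul_of_nonneg_left (hC x) ENNReal.toReal_nonneg

@[simp] theorem expect_const (p : PMF α) (c : ℝ) : expect p (fun _ => c) = c := by
  rw [expect, tsum_mul_right, p.tsum_toReal, one_mul]

@[simp] theorem expect_pure (a : α) (f : α → ℝ) : expect (PMF.pure a) f = f a := by
  rw [expect, tsum_eq_single a]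
  · simp
  · intro b hb
    simp [PMF.pure_apply, hb]

theorem expect_mono_of_ne_zero {p : PMF α} {f g : α → ℝ} (hf : IsBddFun f) (hg : IsBddFun g)
    (h : ∀ x, p x ≠ 0 → f x ≤ g x) : expect p f ≤ expect p g := by
  refine (hf.summable p).tsum_le_tsum (fun x => ?_) (hg.summable p)
  by_cases hx : p x = 0
  · simp [hx]
  · exact mul_le_mul_of_nonneg_left (h x hx) ENNReal.toReal_nonneg

theorem expect_mono {p : PMF α} {f g : α → ℝ} (hf : IsBddFun f) (hg : IsBddFun g)
    (h : ∀ x, f x ≤ g x) : expect p f ≤ expect p g :=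
  expect_mono_of_ne_zero hf hg fun x _ => h x

theorem expect_le {p : PMF α} {f : α → ℝ} (hf : IsBddFun f) {c : ℝ}
    (h : ∀ x, p x ≠ 0 → f x ≤ c) : expect p f ≤ c :=
  (expect_mono_of_ne_zero hf (isBddFun_const c) h).trans_eq (expect_const p c)

theorem le_expect {p : PMF α} {f : α → ℝ} (hf : IsBddFun f) {c : ℝ}
    (h : ∀ x, p x ≠ 0 → c ≤ f x) : c ≤ expect p f :=
  (expect_const p c).symm.trans_le (expect_mono_of_ne_zero (isBddFun_const c) hf h)

theorem expect_mem_Icc {p : PMF α} {f : α → ℝ} {a b : ℝ} (h : ∀ x, f x ∈ Set.Icc a b) :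
    expect p f ∈ Set.Icc a b :=
  ⟨le_expect (isBddFun_of_mem_Icc h) fun x _ => (h x).1,
    expect_le (isBddFun_of_mem_Icc h) fun x _ => (h x).2⟩

theorem abs_expect_le {p : PMF α} {f : α → ℝ} {C : ℝ} (h : ∀ x, |f x| ≤ C) : |expect p f| ≤ C :=
  abs_le.2 (expect_mem_Icc fun x => abs_le.1 (h x))

theorem expect_add {p : PMF α} {f g : α → ℝ} (hf : IsBddFun f) (hg : IsBddFun g) :
    expect p (fun x => f x + g x) = expect p f + expect p g := by
  simp only [expect, mul_add]
  exact (hf.summable p).tsum_add (hg.summable p)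

theorem expect_sub {p : PMF α} {f g : α → ℝ} (hf : IsBddFun f) (hg : IsBddFun g) :
    expect p (fun x => f x - g x) = expect p f - expect p g := by
  simp only [expect, mul_sub]
  exact (hf.summable p).tsum_sub (hg.summable p)

theorem expect_const_mul (p : PMF α) (c : ℝ) (f : α → ℝ) :
    expect p (fun x => c * f x) = c * expect p f := by
  simp only [expect, mul_left_comm _ c]
  exact tsum_mul_left

theorem expect_bind (p : PMF α) (q : α → PMF β) {f : β → ℝ} (hf : IsBddFun f) :
    expect (p.bind q) f = expect p fun x => expect (q x) f := by
  obtain ⟨C, hC⟩ := hf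
  have hsum : Summable fun z : α × β => (p z.1).toReal * ((q z.1 z.2).toReal * f z.2) := by
    have h1 : ∑' z : α × β, p z.1 * q z.1 z.2 ≠ ⊤ := by
      rw [ENNReal.tsum_prod']
      simp [ENNReal.tsum_mul_left, PMF.tsum_coe]
    refine Summable.of_norm_bounded ((ENNReal.summable_toReal h1).mul_right C) fun z => ?_
    rw [← mul_assoc, ← ENNReal.toReal_mul, Real.norm_eq_abs, abs_mul,
      abs_of_nonneg ENNReal.toReal_nonneg]
    exact mul_le_mul_of_nonneg_left (hC _) ENNReal.toReal_nonneg
  have hsum' : Summable (Function.uncurry fun (x : α) (y : β) =>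
      (p x).toReal * ((q x y).toReal * f y)) := hsum
  calc expect (p.bind q) f
      = ∑' y, ∑' x, (p x).toReal * ((q x y).toReal * f y) := by
        refine tsum_congr fun y => ?_
        rw [PMF.bind_apply, ENNReal.tsum_toReal_eq
          fun x => ENNReal.mul_ne_top (p.apply_ne_top x) ((q x).apply_ne_top y), ← tsum_mul_right]
        exact tsum_congr fun x => by rw [ENNReal.toReal_mul, mul_assoc]
    _ = ∑' x, ∑' y, (p x).toReal * ((q x y).toReal * f y) := hsum'.tsum_comm
    _ = expect p fun x => expect (q x) f := tsum_congr fun x => tsum_mul_left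

theorem expect_map (p : PMF α) (g : α → β) {f : β → ℝ} (hf : IsBddFun f) :
    expect (p.map g) f = expect p fun x => f (g x) := by
  rw [PMF.map, expect_bind p _ hf]
  simp

/-- If a bounded function with expectation at least `c` never exceeds `c`, it equals `c` at every
point of positive probability. -/
theorem eq_of_le_expect {p : PMF α} {f : α → ℝ} (hf : IsBddFun f) {c : ℝ} (h : ∀ x, f x ≤ c)
    (hc : c ≤ expect p f) {x : α} (hx : p x ≠ 0) : f x = c := by
  have hb : IsBddFun fun x => c - f x := (isBddFun_const c).sub hf
  have h0 : expect p (fun x => c - f x) = 0 := by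
    refine le_antisymm ?_ (le_expect hb fun x _ => sub_nonneg.2 (h x))
    rw [expect_sub (isBddFun_const c) hf, expect_const]
    linarith
  have h1 : (p x).toReal * (c - f x) ≤ 0 := by
    rw [← h0]
    exact (hb.summable p).le_tsum x fun y _ =>
      mul_nonneg ENNReal.toReal_nonneg (sub_nonneg.2 (h y))
  have h2 : 0 < (p x).toReal := ENNReal.toReal_pos hx (p.apply_ne_top x)
  have h3 := h x
  nlinarith

end Expect

/-! ### Discounted values and the Bellman equation -/

namespace MDP

variable {S A : Type*} {γ : ℝ}

/-- The value of taking the action `a` at `s` and collecting the terminal payoff `f` one step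
later, discounted by `γ`. -/
def qValue (M : MDP S A) (γ : ℝ) (f : S → ℝ) (s : S) (a : A) : ℝ :=
  M.reward s a + γ * expect (M.trans s a) f

/-- All rewards lie in the unit interval. -/
def UnitReward (M : MDP S A) : Prop := ∀ s a, M.reward s a ∈ Set.Icc (0 : ℝ) 1

theorem UnitReward.abs_qValue_le {M : MDP S A} (hM : M.UnitReward) (hγ : 0 ≤ γ) {f : S → ℝ} {C : ℝ}
    (hf : ∀ s, |f s| ≤ C) (s : S) (a : A) : |M.qValue γ f s a| ≤ 1 + γ * C := by
  refine (abs_add_le _ _).trans (add_le_add ?_ ?_)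
  · rw [abs_of_nonneg (hM s a).1]
    exact (hM s a).2
  · rw [abs_mul, abs_of_nonneg hγ]
    exact mul_le_mul_of_nonneg_left (abs_expect_le hf) hγ

theorem summable_geometric_expect (hγ : 0 ≤ γ) (hγ1 : γ < 1) {X : Type*} (p : ℕ → PMF X)
    {f : X → ℝ} (hf : IsBddFun f) : Summable fun n => γ ^ n * expect (p n) f := by
  obtain ⟨C, hC⟩ := hf
  refine Summable.of_norm_bounded ((summable_geometric_of_lt_one hγ hγ1).mul_right C) fun n => ?_
  rw [Real.norm_eq_abs, abs_mul, abs_of_nonneg (pow_nonneg hγ n)]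
  exact mul_le_mul_of_nonneg_left (abs_expect_le hC) (pow_nonneg hγ n)

/-- Telescoping: the value of a policy differs from any bounded function `f` by the discounted sum
of the expected one-step defects of `f` along the trajectory. -/
theorem UnitReward.value_eq_add_tsum {M : MDP S A} (hM : M.UnitReward) (hγ : 0 ≤ γ) (hγ1 : γ < 1)
    {f : S → ℝ} (hf : IsBddFun f) (π : S → PMF A) (s : S) :
    M.value γ π s = f s + ∑' n : ℕ, γ ^ n *
      expect (M.stateLaw π s n) fun s' => expect (π s') (M.qValue γ f s') - f s' := by
  have hR : IsBddFun fun s' => expect (π s') (M.reward s') :=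
    isBddFun_of_mem_Icc fun s' => expect_mem_Icc (hM s')
  have hRs : ∀ s', IsBddFun (M.reward s') := fun s' => isBddFun_of_mem_Icc (hM s')
  have hF : IsBddFun fun s' => expect (π s') fun a => expect (M.trans s' a) f := by
    obtain ⟨C, hC⟩ := hf
    exact ⟨C, fun s' => abs_expect_le fun a => abs_expect_le hC⟩
  have hFs : ∀ s', IsBddFun fun a => expect (M.trans s' a) f := fun s' => by
    obtain ⟨C, hC⟩ := hf
    exact ⟨C, fun a => abs_expect_le hC⟩
  have hnext : ∀ n, expect (M.stateLaw π s n) (fun s' => expect (π s') fun a =>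
      expect (M.trans s' a) f) = expect (M.stateLaw π s (n + 1)) f := fun n => by
    rw [stateLaw, expect_bind _ _ hf]
    exact congrArg _ (funext fun s' => (expect_bind _ _ hf).symm)
  have hterm : ∀ n, γ ^ n * expect (M.stateLaw π s n)
      (fun s' => expect (π s') (M.qValue γ f s') - f s') =
      γ ^ n * expect (M.stateLaw π s n) (fun s' => expect (π s') (M.reward s')) +
      (γ ^ (n + 1) * expect (M.stateLaw π s (n + 1)) f - γ ^ n * expect (M.stateLaw π s n) f) := by
    intro n
    have h1 : ∀ s', expect (π s') (M.qValue γ f s') = expect (π s') (M.reward s') +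
        γ * expect (π s') fun a => expect (M.trans s' a) f := fun s' => by
      rw [← expect_const_mul, ← expect_add (hRs s') ((hFs s').const_mul γ)]
      rfl
    simp only [h1]
    rw [expect_sub (hR.add (hF.const_mul γ)) hf, expect_add hR (hF.const_mul γ), expect_const_mul,
      hnext]
    ring
  have hsR := summable_geometric_expect hγ hγ1 (M.stateLaw π s) hR
  have hsf := summable_geometric_expect hγ hγ1 (M.stateLaw π s) hf
  have hsf' := (summable_nat_add_iff 1).2 hsf
  rw [tsum_congr hterm, hsR.tsum_add (hsf'.sub hsf), hsf'.tsum_sub hsf, hsf.tsum_eq_zero_add]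
  simp only [pow_zero, one_mul, stateLaw, expect_pure, MDP.value]
  ring

section Defect

variable {M : MDP S A} (hM : M.UnitReward) (hγ : 0 ≤ γ) (hγ1 : γ < 1)
  {f : S → ℝ} (hf : IsBddFun f) (π : S → PMF A)
include hM hγ hf

theorem UnitReward.isBddFun_qValue (s : S) : IsBddFun (M.qValue γ f s) := by
  obtain ⟨C, hC⟩ := hf
  exact ⟨_, hM.abs_qValue_le hγ hC s⟩

theorem UnitReward.isBddFun_defect :
    IsBddFun fun s => expect (π s) (M.qValue γ f s) - f s := by
  refine IsBddFun.sub ?_ hf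
  obtain ⟨C, hC⟩ := hf
  exact ⟨_, fun s => abs_expect_le (hM.abs_qValue_le hγ hC s)⟩

include hγ1

theorem UnitReward.value_le (h : ∀ s, expect (π s) (M.qValue γ f s) ≤ f s) (s : S) :
    M.value γ π s ≤ f s := by
  rw [hM.value_eq_add_tsum hγ hγ1 hf π s, add_le_iff_nonpos_right]
  exact tsum_nonpos fun n => mul_nonpos_of_nonneg_of_nonpos (pow_nonneg hγ n)
    (expect_le (hM.isBddFun_defect hγ hf π) fun s' _ => sub_nonpos.2 (h s'))

theorem UnitReward.sub_le_value {η : ℝ} (h : ∀ s, f s - η ≤ expect (π s) (M.qValue γ f s)) (s : S) :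
    f s - η / (1 - γ) ≤ M.value γ π s := by
  have hb := hM.isBddFun_defect hγ hf π
  rw [hM.value_eq_add_tsum hγ hγ1 hf π s, sub_eq_add_neg, add_le_add_iff_left, div_eq_inv_mul,
    ← mul_neg, ← tsum_geometric_of_lt_one hγ hγ1, ← tsum_mul_right]
  refine ((summable_geometric_of_lt_one hγ hγ1).mul_right _).tsum_le_tsum (fun n => ?_)
    (summable_geometric_expect hγ hγ1 _ hb)
  refine mul_le_mul_of_nonneg_left (le_expect hb fun s' _ => ?_) (pow_nonneg hγ n)
  linarith [h s']

/-- A policy whose value attains an upper solution `f` of the Bellman equation at `s` has no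
one-step defect at `s`. -/
theorem UnitReward.le_expect_qValue_of_le_value (h : ∀ s a, M.qValue γ f s a ≤ f s) {s : S}
    (hv : f s ≤ M.value γ π s) : f s ≤ expect (π s) (M.qValue γ f s) := by
  have hb := hM.isBddFun_defect hγ hf π
  have hle : ∀ s', expect (π s') (M.qValue γ f s') - f s' ≤ 0 := fun s' =>
    sub_nonpos.2 (expect_le (hM.isBddFun_qValue hγ hf s') fun a _ => h s' a)
  have hnp : ∀ n, γ ^ n * expect (M.stateLaw π s n)
      (fun s' => expect (π s') (M.qValue γ f s') - f s') ≤ 0 := fun n =>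
    mul_nonpos_of_nonneg_of_nonpos (pow_nonneg hγ n) (expect_le hb fun s' _ => hle s')
  have hs := summable_geometric_expect hγ hγ1 (M.stateLaw π s) hb
  have h0 := (hs.neg).le_tsum 0 fun n _ => neg_nonneg.2 (hnp n)
  rw [tsum_neg] at h0
  rw [hM.value_eq_add_tsum hγ hγ1 hf π s] at hv
  simp only [pow_zero, one_mul, stateLaw, expect_pure] at h0
  linarith

end Defect

theorem UnitReward.value_nonneg {M : MDP S A} (hM : M.UnitReward) (hγ : 0 ≤ γ) (π : S → PMF A)
    (s : S) : 0 ≤ M.value γ π s := by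
  refine tsum_nonneg fun n => mul_nonneg (pow_nonneg hγ n) ?_
  exact (expect_mem_Icc fun s' => expect_mem_Icc (hM s')).1

/-- `v` is a bounded solution of the Bellman optimality equation. -/
structure IsBellman (M : MDP S A) (γ : ℝ) (v : S → ℝ) : Prop where
  isBddFun : IsBddFun v
  qValue_le : ∀ s a, M.qValue γ v s a ≤ v s
  exists_eq : ∀ s, ∃ a, v s = M.qValue γ v s a

/-- The Bellman optimality operator is a contraction of the space of bounded functions, hence has a
fixed point. -/
theorem UnitReward.exists_isBellman [Finite A] [Nonempty A] {M : MDP S A} (hM : M.UnitReward)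
    (hγ : 0 ≤ γ) (hγ1 : γ < 1) : ∃ v, M.IsBellman γ v := by
  let _ : TopologicalSpace S := ⊥
  have : DiscreteTopology S := ⟨rfl⟩
  have habs : ∀ (v : BoundedContinuousFunction S ℝ) s, |v s| ≤ ‖v‖ := fun v s =>
    v.norm_coe_le_norm s
  have hbdd : ∀ v s, BddAbove (Set.range (M.qValue γ v s)) := fun v s =>
    (Set.finite_range _).bddAbove
  let T : BoundedContinuousFunction S ℝ → BoundedContinuousFunction S ℝ := fun v =>
    BoundedContinuousFunction.ofNormedAddCommGroupDiscrete (fun s => ⨆ a, M.qValue γ v s a)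
      (1 + γ * ‖v‖) fun s => by
        obtain ⟨a, ha⟩ := exists_eq_ciSup_of_finite (f := M.qValue γ v s)
        rw [← ha]
        exact hM.abs_qValue_le hγ (habs v) s a
  have hT : ∀ v s, T v s = ⨆ a, M.qValue γ v s a := fun _ _ => rfl
  have hle : ∀ v w s, T v s ≤ T w s + γ * dist v w := fun v w s => by
    rw [hT, hT]
    refine ciSup_le fun a => ?_
    refine le_trans ?_ (add_le_add_left (le_ciSup (hbdd w s) a) _)
    have hE : expect (M.trans s a) v ≤ expect (M.trans s a) w + dist v w := by
      rw [← expect_const (M.trans s a) (dist v w), ← expect_add ⟨_, habs w⟩ (isBddFun_const _)]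
      refine expect_mono ⟨_, habs v⟩ (IsBddFun.add ⟨_, habs w⟩ (isBddFun_const _)) fun s' => ?_
      have := (le_abs_self _).trans (v.dist_coe_le_dist (g := w) s')
      linarith
    simp only [qValue]
    nlinarith
  have hcontr : ContractingWith ⟨γ, hγ⟩ T := by
    refine ⟨hγ1, LipschitzWith.of_dist_le_mul fun v w => ?_⟩
    refine (BoundedContinuousFunction.dist_le (mul_nonneg hγ dist_nonneg)).2 fun s => ?_
    rw [Real.dist_eq, abs_le]
    have h1 := hle v w s
    have h2 := hle w v s
    rw [dist_comm w v] at h2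
    change -(γ * dist v w) ≤ _ ∧ _ ≤ γ * dist v w
    constructor <;> linarith
  have hfix : T (hcontr.fixedPoint T) = hcontr.fixedPoint T := hcontr.fixedPoint_isFixedPt
  set v := hcontr.fixedPoint T
  have hv : ∀ s, v s = ⨆ a, M.qValue γ v s a := fun s => by rw [← hT, hfix]
  refine ⟨v, ⟨_, habs v⟩, fun s a => ?_, fun s => ?_⟩
  · rw [hv s]
    exact le_ciSup (hbdd v s) a
  · obtain ⟨a, ha⟩ := exists_eq_ciSup_of_finite (f := M.qValue γ v s)
    exact ⟨a, by rw [hv s, ha]⟩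

namespace IsBellman

variable {M : MDP S A} {v : S → ℝ} (hv : M.IsBellman γ v) (hM : M.UnitReward) (hγ : 0 ≤ γ)
  (hγ1 : γ < 1)
include hv hM hγ hγ1

theorem value_le (π : S → PMF A) (s : S) : M.value γ π s ≤ v s :=
  hM.value_le hγ hγ1 hv.isBddFun π
    (fun s => expect_le (hM.isBddFun_qValue hγ hv.isBddFun s) fun a _ => hv.qValue_le s a) s

/-- The policy that is greedy for a Bellman solution attains it. -/
theorem exists_value_eq : ∃ π : S → PMF A, ∀ s, M.value γ π s = v s := by
  choose a ha using hv.exists_eq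
  refine ⟨fun s => PMF.pure (a s), fun s => le_antisymm (hv.value_le hM hγ hγ1 _ s) ?_⟩
  have := hM.sub_le_value hγ hγ1 hv.isBddFun (fun s => PMF.pure (a s)) (η := 0)
    (fun s => by rw [sub_zero, expect_pure, ← ha s]) s
  simpa using this

theorem mem_Icc (s : S) : v s ∈ Set.Icc 0 (1 - γ)⁻¹ := by
  obtain ⟨π, hπ⟩ := hv.exists_value_eq hM hγ hγ1
  have h1 : 0 < 1 - γ := sub_pos.2 hγ1
  rw [← hπ s]
  refine ⟨hM.value_nonneg hγ π s, hM.value_le hγ hγ1 (isBddFun_const _) π (fun s' => ?_) s⟩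
  refine expect_le (hM.isBddFun_qValue hγ (isBddFun_const _) s') fun a _ => ?_
  rw [qValue, expect_const]
  calc M.reward s' a + γ * (1 - γ)⁻¹ ≤ 1 + γ * (1 - γ)⁻¹ := by gcongr; exact (hM s' a).2
    _ = (1 - γ)⁻¹ := by field_simp; ring

/-- An optimal policy only takes actions that attain the maximum in the Bellman equation. -/
theorem qValue_eq_of_isOptimal {π : S → PMF A} (hπ : M.IsOptimal γ π) {s : S} {a : A}
    (ha : π s a ≠ 0) : M.qValue γ v s a = v s := by
  obtain ⟨π', hπ'⟩ := hv.exists_value_eq hM hγ hγ1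
  exact eq_of_le_expect (hM.isBddFun_qValue hγ hv.isBddFun s) (hv.qValue_le s)
    (hM.le_expect_qValue_of_le_value hγ hγ1 hv.isBddFun π hv.qValue_le
      ((hπ' s).symm.trans_le (hπ π' s))) ha

end IsBellman

end MDP

/-! ### The decision process on histories -/

namespace Environment

variable {E A : Type*} (env : Environment E A)

/-- An environment as a Markov decision process whose states are the histories. -/
def toMDP : MDP (History E A) A where
  trans h a := (env.trans h a).map fun e => h.step a e
  reward := env.actionReward

theorem meanReward_mem_Icc (h : History E A) : env.meanReward h ∈ Set.Icc (0 : ℝ) 1 := by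
  have hint : Integrable (fun x : Set.Icc (0 : ℝ) 1 => (x : ℝ)) (env.reward h : Measure _) :=
    Integrable.of_bound (by fun_prop) 1
      (Filter.Eventually.of_forall fun x => by
        rw [Real.norm_eq_abs, abs_of_nonneg x.2.1]; exact x.2.2)
  refine ⟨integral_nonneg fun x => x.2.1, ?_⟩
  calc env.meanReward h ≤ ∫ _, (1 : ℝ) ∂(env.reward h : Measure (Set.Icc (0 : ℝ) 1)) :=
        integral_mono hint (integrable_const _) fun x => x.2.2
    _ = 1 := by simp

theorem isBddFun_meanReward : IsBddFun env.meanReward :=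
  isBddFun_of_mem_Icc env.meanReward_mem_Icc

theorem unitReward_toMDP : env.toMDP.UnitReward := fun h a =>
  expect_mem_Icc fun e => env.meanReward_mem_Icc (h.step a e)

theorem qValue_toMDP (γ : ℝ) {f : History E A → ℝ} (hf : IsBddFun f) (h : History E A) (a : A) :
    env.toMDP.qValue γ f h a =
      env.actionReward h a + γ * expect (env.trans h a) fun e => f (h.step a e) := by
  rw [MDP.qValue, toMDP, expect_map _ _ hf]

theorem historyLaw_eq_stateLaw (π : Policy E A) (h : History E A) (n : ℕ) :
    env.historyLaw π h n = env.toMDP.stateLaw π h n := by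
  induction n with
  | zero => rfl
  | succ n ih => rw [historyLaw, MDP.stateLaw, ih]; rfl

theorem value_eq_value_toMDP (γ : ℝ) (π : Policy E A) (h : History E A) :
    env.value γ π h = env.toMDP.value γ π h := by
  refine tsum_congr fun n => ?_
  rw [historyLaw_eq_stateLaw, MDP.stateLaw, expect_bind _ _ env.isBddFun_meanReward]
  refine congrArg _ (congrArg _ (funext fun h' => ?_))
  rw [expect_bind _ _ env.isBddFun_meanReward]
  refine congrArg _ (funext fun a => ?_)
  rw [toMDP, expect_map _ _ env.isBddFun_meanReward]
  rfl

theorem isNearOptimal_of_sub_le [Nonempty A] {γ δ : ℝ} (hγ : 0 ≤ γ) (hγ1 : γ < 1)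
    {v : History E A → ℝ} (hv : env.toMDP.IsBellman γ v) {π : Policy E A}
    (h : ∀ h, v h - δ ≤ env.toMDP.value γ π h) : env.IsNearOptimal γ δ π := by
  intro h'
  have hle : ∀ π' : Policy E A, env.value γ π' h' ≤ v h' := fun π' => by
    rw [value_eq_value_toMDP]
    exact hv.value_le env.unitReward_toMDP hγ hγ1 π' h'
  have : Nonempty (Policy E A) := ⟨fun _ => PMF.pure (Classical.arbitrary A)⟩
  have h1 : env.optValue γ h' ≤ v h' := ciSup_le hle
  have h2 : env.value γ π h' ≤ env.optValue γ h' :=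
    le_ciSup (f := fun π' => env.value γ π' h') ⟨v h', by rintro _ ⟨π', rfl⟩; exact hle π'⟩ π
  have h3 := h h'
  rw [← value_eq_value_toMDP] at h3
  rw [abs_of_nonneg (sub_nonneg.2 h2)]
  linarith

/-- A policy whose one-step defect with respect to a Bellman solution is at most `η` everywhere is
`η / (1 - γ)`-optimal. -/
theorem isNearOptimal_of_defect_le [Nonempty A] {γ η : ℝ} (hγ : 0 ≤ γ) (hγ1 : γ < 1)
    {v : History E A → ℝ} (hv : env.toMDP.IsBellman γ v) {π : Policy E A}
    (h : ∀ h, v h - η ≤ expect (π h) (env.toMDP.qValue γ v h)) :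
    env.IsNearOptimal γ (η / (1 - γ)) π :=
  env.isNearOptimal_of_sub_le hγ hγ1 hv
    (env.unitReward_toMDP.sub_le_value hγ hγ1 hv.isBddFun π h)

/-- Every policy is near-optimal within `1 / (1 - γ)`, since that is the range of the values. -/
theorem isNearOptimal_of_one_le [Finite A] [Nonempty A] {γ ε : ℝ} (hγ : 0 ≤ γ) (hγ1 : γ < 1)
    (hε : 1 ≤ ε) (π : Policy E A) : env.IsNearOptimal γ (ε / (1 - γ)) π := by
  obtain ⟨W, hW⟩ := env.unitReward_toMDP.exists_isBellman hγ hγ1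
  refine env.isNearOptimal_of_sub_le hγ hγ1 hW fun h => ?_
  have h1 := (hW.mem_Icc env.unitReward_toMDP hγ hγ1 h).2
  have h2 : (1 - γ)⁻¹ ≤ ε / (1 - γ) := by
    rw [inv_eq_one_div]
    exact div_le_div_of_nonneg_right hε (sub_pos.2 hγ1).le
  have h3 := env.unitReward_toMDP.value_nonneg hγ π h
  linarith

end Environment

/-! ### Surrogates of abstractions that respect near-optimal actions -/

section Surrogate

variable {E A S : Type*} {env : Environment E A} {ψ : History E A → S} (D : Dispersion ψ)

theorem unitReward_surrogate : (surrogate env ψ D).UnitReward := fun _ a =>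
  expect_mem_Icc fun _ => expect_mem_Icc fun h => env.unitReward_toMDP h a

/-- The action value of a surrogate at `s` is an average, over histories in the class `s`, of the
action value on histories of the lifted payoff. -/
theorem qValue_surrogate {l : ℝ} {v : S → ℝ} (hv : IsBddFun v) (s : S) (a : A) :
    (surrogate env ψ D).qValue l v s a = expect (D.w s a) fun m => expect (D.B m s a) fun h =>
      env.toMDP.qValue l (fun h' => v (ψ h')) h a := by
  obtain ⟨C, hC⟩ := id hv
  have hR : IsBddFun fun h => env.actionReward h a :=
    isBddFun_of_mem_Icc fun h => env.unitReward_toMDP h a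
  have hF : IsBddFun fun h => expect (env.trans h a) fun e => v (ψ (h.step a e)) :=
    ⟨C, fun h => abs_expect_le fun e => hC _⟩
  have hR' : IsBddFun fun m => expect (D.B m s a) fun h => env.actionReward h a :=
    isBddFun_of_mem_Icc fun _ => expect_mem_Icc fun h => env.unitReward_toMDP h a
  have hF' : IsBddFun fun m => expect (D.B m s a) fun h =>
      expect (env.trans h a) fun e => v (ψ (h.step a e)) :=
    ⟨C, fun _ => abs_expect_le fun h => abs_expect_le fun e => hC _⟩
  rw [MDP.qValue]
  simp only [env.qValue_toMDP l (hv.comp ψ), surrogate, expect_bind _ _ hv, expect_map _ _ hv,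
    expect_add hR (hF.const_mul l), expect_const_mul, expect_add hR' (hF'.const_mul l)]

section Bounds

variable {l : ℝ} (hl : 0 ≤ l) {v : S → ℝ} (hv : IsBddFun v) {s : S} {a : A} {c : ℝ}
include hl hv

theorem isBddFun_qValue_lift :
    IsBddFun fun h => env.toMDP.qValue l (fun h' => v (ψ h')) h a := by
  obtain ⟨C, hC⟩ := hv.comp ψ
  exact ⟨_, fun h => env.unitReward_toMDP.abs_qValue_le hl hC h a⟩

theorem qValue_surrogate_le
    (h : ∀ h, ψ h = s → env.toMDP.qValue l (fun h' => v (ψ h')) h a ≤ c) :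
    (surrogate env ψ D).qValue l v s a ≤ c := by
  rw [qValue_surrogate D hv]
  have hq := isBddFun_qValue_lift (env := env) (ψ := ψ) (a := a) hl hv
  exact expect_le (hq.imp fun _ hC _ => abs_expect_le hC) fun m hm => expect_le hq fun h' hh =>
    h h' (D.support_B m s a h' hm hh).2

theorem le_qValue_surrogate
    (h : ∀ h, ψ h = s → c ≤ env.toMDP.qValue l (fun h' => v (ψ h')) h a) :
    c ≤ (surrogate env ψ D).qValue l v s a := by
  rw [qValue_surrogate D hv]
  have hq := isBddFun_qValue_lift (env := env) (ψ := ψ) (a := a) hl hv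
  exact le_expect (hq.imp fun _ hC _ => abs_expect_le hC) fun m hm => le_expect hq fun h' hh =>
    h h' (D.support_B m s a h' hm hh).2

end Bounds

/-- Let `U` be the optimal value on histories. If the histories of each class have values within
`δ` of each other, a common optimal action `β`, and the same `τ`-optimal actions, where `τ` exceeds
the error `2δ / (1 - l)` of the surrogate's action values, then an optimal policy of the surrogate
only takes `τ`-optimal actions. -/
theorem le_qValue_of_isOptimal_surrogate [Finite A] [Nonempty A] {l δ τ : ℝ} (hl : 0 ≤ l)
    (hl1 : l < 1) {U : History E A → ℝ} (hU : env.toMDP.IsBellman l U)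
    (hδ : ∀ h h', ψ h = ψ h' → |U h - U h'| ≤ δ) {β : S → A}
    (hβ : ∀ h, U h = env.toMDP.qValue l U h (β (ψ h)))
    (hτ : ∀ h h' a, ψ h = ψ h' → U h - τ ≤ env.toMDP.qValue l U h a →
      U h' - τ ≤ env.toMDP.qValue l U h' a)
    (hδτ : 2 * δ / (1 - l) < τ) {π : S → PMF A} (hπ : (surrogate env ψ D).IsOptimal l π)
    (h : History E A) {a : A} (ha : π (ψ h) a ≠ 0) :
    U h - τ ≤ env.toMDP.qValue l U h a := by
  obtain ⟨v, hv⟩ := (unitReward_surrogate (env := env) D).exists_isBellman hl hl1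
  have hvψ := hv.isBddFun.comp ψ
  have hb : IsBddFun fun h => |v (ψ h) - U h| := by
    obtain ⟨C, hC⟩ := hvψ.sub hU.isBddFun
    exact ⟨C, fun h => by rw [abs_abs]; exact hC h⟩
  -- `κ` is the largest deviation of the surrogate's value from `U`.
  set κ := ⨆ h, |v (ψ h) - U h|
  have hκ : ∀ h, |v (ψ h) - U h| ≤ κ := fun h => by
    obtain ⟨C, hC⟩ := hb
    exact le_ciSup (f := fun h => |v (ψ h) - U h|)
      ⟨C, by rintro _ ⟨h, rfl⟩; exact (le_abs_self _).trans (hC h)⟩ h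
  have hq : ∀ h a, |env.toMDP.qValue l (fun h' => v (ψ h')) h a - env.toMDP.qValue l U h a| ≤
      l * κ := fun h a => by
    rw [MDP.qValue, MDP.qValue, add_sub_add_left_eq_sub, ← mul_sub, ← expect_sub hvψ hU.isBddFun,
      abs_mul, abs_of_nonneg hl]
    exact mul_le_mul_of_nonneg_left (abs_expect_le hκ) hl
  have hup : ∀ h a, (surrogate env ψ D).qValue l v (ψ h) a ≤ U h + δ + l * κ := fun h a =>
    qValue_surrogate_le D hl hv.isBddFun fun h' hh => by
      linarith [(abs_le.1 (hq h' a)).2, hU.qValue_le h' a, (abs_le.1 (hδ h' h hh)).2]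
  have hlow : ∀ h, U h - δ - l * κ ≤ (surrogate env ψ D).qValue l v (ψ h) (β (ψ h)) := fun h =>
    le_qValue_surrogate D hl hv.isBddFun fun h' hh => by
      linarith [(abs_le.1 (hq h' (β (ψ h)))).1, hh ▸ hβ h', (abs_le.1 (hδ h' h hh)).1]
  have hκδ : κ ≤ δ + l * κ := by
    have : Nonempty (History E A) := ⟨h⟩
    refine ciSup_le fun h => abs_le.2 ⟨?_, ?_⟩
    · linarith [hlow h, hv.qValue_le (ψ h) (β (ψ h))]
    · obtain ⟨b, hb⟩ := hv.exists_eq (ψ h)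
      linarith [hup h b]
  by_contra! hlt
  have hbad : (surrogate env ψ D).qValue l v (ψ h) a ≤ U h - τ + δ + l * κ :=
    qValue_surrogate_le D hl hv.isBddFun fun h' hh => by
      have h1 : env.toMDP.qValue l U h' a < U h' - τ := by
        by_contra! hge
        exact hlt.not_ge (hτ h' h a hh hge)
      linarith [(abs_le.1 (hq h' a)).2, (abs_le.1 (hδ h' h hh)).2]
  have hopt := hv.qValue_eq_of_isOptimal (unitReward_surrogate D) hl hl1 hπ ha
  have h2 := hlow h
  have h3 := hv.qValue_le (ψ h) (β (ψ h))
  rw [div_lt_iff₀ (sub_pos.2 hl1)] at hδτ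
  -- The three bounds give `τ ≤ 2 (δ + l κ)`, while `(1 - l) κ ≤ δ`.
  have h4 : τ ≤ 2 * (δ + l * κ) := by linarith
  have h5 : (δ + l * κ) * (1 - l) ≤ δ := by nlinarith
  nlinarith [mul_le_mul_of_nonneg_right h4 (sub_nonneg.2 hl1.le)]

end Surrogate

/-! ### The Bellman solution of the binarized environment -/

namespace BinaryCode

section Completion

variable {A : Type*} {d : ℕ} (c : BinaryCode A d) (l : ℝ) (f : A → ℝ)

/-- The best payoff, discounted by `l` per bit, of completing the word `w` by `k` further bits when
the decoded action pays `f`. -/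
def bestCompletion : ℕ → List Bool → ℝ
  | 0, w => f (c.dec w)
  | k + 1, w => l * max (bestCompletion k (w ++ [false])) (bestCompletion k (w ++ [true]))

variable {l f}

theorem bestCompletion_mem_Icc (hl : 0 ≤ l) (hl1 : l ≤ 1) {C : ℝ} (hf : ∀ a, f a ∈ Set.Icc 0 C)
    (k : ℕ) (w : List Bool) : c.bestCompletion l f k w ∈ Set.Icc 0 C := by
  induction k generalizing w with
  | zero => exact hf _
  | succ k ih =>
    have h0 := ih (w ++ [false])
    have h1 := ih (w ++ [true])
    have hm : 0 ≤ max (c.bestCompletion l f k (w ++ [false]))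
      (c.bestCompletion l f k (w ++ [true])) := le_max_of_le_left h0.1
    exact ⟨mul_nonneg hl hm, (mul_le_of_le_one_left hm hl1).trans (max_le h0.2 h1.2)⟩

theorem bestCompletion_le (hl : 0 ≤ l) {m : ℝ} (hf : ∀ a, f a ≤ m) (k : ℕ) (w : List Bool) :
    c.bestCompletion l f k w ≤ l ^ k * m := by
  induction k generalizing w with
  | zero => simpa [bestCompletion] using hf _
  | succ k ih =>
    rw [bestCompletion, pow_succ', mul_assoc]
    exact mul_le_mul_of_nonneg_left (max_le (ih _) (ih _)) hl

theorem le_bestCompletion (hl : 0 ≤ l) (w u : List Bool) :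
    l ^ u.length * f (c.dec (w ++ u)) ≤ c.bestCompletion l f u.length w := by
  induction u generalizing w with
  | nil => simp [bestCompletion]
  | cons x u ih =>
    have h := ih (w ++ [x])
    rw [List.append_assoc, List.singleton_append] at h
    rw [List.length_cons, bestCompletion, pow_succ', mul_assoc]
    refine mul_le_mul_of_nonneg_left (h.trans ?_) hl
    cases x
    · exact le_max_left _ _
    · exact le_max_right _ _

/-- Since every action has a code, starting from the empty word the best completion attains the
maximal payoff. -/
theorem bestCompletion_nil (hl : 0 ≤ l) {m : ℝ} (hf : ∀ a, f a ≤ m) (hm : ∃ a, m = f a) :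
    c.bestCompletion l f d [] = l ^ d * m := by
  refine le_antisymm (c.bestCompletion_le hl hf d []) ?_
  obtain ⟨a, rfl⟩ := hm
  have := c.le_bestCompletion (f := f) hl [] (c.enc a)
  rwa [c.length_enc, List.nil_append, c.dec_enc] at this

end Completion

section Binarized

variable {E A : Type*} {d : ℕ} (c : BinaryCode A d) (filler : History E Bool → Bool → E)
  (env : Environment E A)

theorem length_decode_lt (hd : 0 < d) (g : History E Bool) : (c.decode g).2.length < d := by
  induction g with
  | init e => exact hd
  | step g x e ih =>
    simp only [decode]
    split_ifs with h
    · exact hd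
    · rw [List.length_append, List.length_singleton]
      omega

theorem decode_step_of_eq {g : History E Bool} (h : (c.decode g).2.length + 1 = d) (x : Bool)
    (e : E) : c.decode (g.step x e) =
      ((c.decode g).1.step (c.dec ((c.decode g).2 ++ [x])) e, []) := by
  simp only [decode, h, if_true]

theorem decode_step_of_ne {g : History E Bool} (h : (c.decode g).2.length + 1 ≠ d) (x : Bool)
    (e : E) : c.decode (g.step x e) = ((c.decode g).1, (c.decode g).2 ++ [x]) := by
  simp only [decode, h, if_false]

theorem meanReward_binarize (g : History E Bool) : (c.binarize filler env).meanReward g =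
    if (c.decode g).2 = [] then env.meanReward (c.decode g).1 else 0 := by
  by_cases h : (c.decode g).2 = []
  · simp [Environment.meanReward, binarize, h]
  · simp [Environment.meanReward, binarize, h]

/-- The action value, in the binarized environment, of the bit `x` at `g`, expressed by the action
values `q` of the original environment: the best completion of the enlarged word. -/
def bitValue (l : ℝ) (q : History E A → A → ℝ) (g : History E Bool) (x : Bool) : ℝ :=
  c.bestCompletion l (q (c.decode g).1) (d - ((c.decode g).2.length + 1)) ((c.decode g).2 ++ [x])

/-- The optimal value in the binarized environment, as the larger of the two values of a bit. -/
def maxBitValue (l : ℝ) (q : History E A → A → ℝ) (g : History E Bool) : ℝ :=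
  max (c.bitValue l q g false) (c.bitValue l q g true)

theorem mul_maxBitValue (l : ℝ) (q : History E A → A → ℝ) {g : History E Bool} {h : History E A}
    {w : List Bool} {k : ℕ} (hg : c.decode g = (h, w)) (hk : w.length + (k + 1) = d) :
    l * c.maxBitValue l q g = c.bestCompletion l (q h) (k + 1) w := by
  have : d - (w.length + 1) = k := by omega
  simp only [maxBitValue, bitValue, hg, this, bestCompletion]

variable {c filler env} {l γ : ℝ} {W : History E A → ℝ}

theorem qValue_binarize (hl : 0 ≤ l) (hlγ : l ^ d = γ) (hd : 0 < d)
    (hW : env.toMDP.IsBellman γ W)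
    (hb : IsBddFun (c.maxBitValue l (env.toMDP.qValue γ W))) (g : History E Bool) (x : Bool) :
    (c.binarize filler env).toMDP.qValue l (c.maxBitValue l (env.toMDP.qValue γ W)) g x =
      c.bitValue l (env.toMDP.qValue γ W) g x := by
  rw [Environment.qValue_toMDP _ _ hb, Environment.actionReward, bitValue]
  by_cases h : (c.decode g).2.length + 1 = d
  · have htrans : (c.binarize filler env).trans g x =
        env.trans (c.decode g).1 (c.dec ((c.decode g).2 ++ [x])) := by
      simp only [binarize, h, if_true]
    have hnext : ∀ e, l * c.maxBitValue l (env.toMDP.qValue γ W) (g.step x e) =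
        γ * W ((c.decode g).1.step (c.dec ((c.decode g).2 ++ [x])) e) := fun e => by
      rw [c.mul_maxBitValue l _ (c.decode_step_of_eq h x e) (k := d - 1)
        (by rw [List.length_nil]; omega), Nat.sub_add_cancel hd,
        c.bestCompletion_nil hl (hW.qValue_le _) (hW.exists_eq _), hlγ]
    rw [htrans, ← expect_const_mul]
    simp only [hnext, meanReward_binarize, c.decode_step_of_eq h, if_true]
    rw [h, Nat.sub_self, bestCompletion, Environment.qValue_toMDP _ _ hW.isBddFun,
      expect_const_mul]
    rfl
  · have hlt := c.length_decode_lt hd g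
    have htrans : (c.binarize filler env).trans g x = PMF.pure (filler g x) := by
      simp only [binarize, h, if_false]
    have hk : d - ((c.decode g).2.length + 1) = d - ((c.decode g).2.length + 2) + 1 := by omega
    rw [htrans, expect_pure, expect_pure, meanReward_binarize, c.decode_step_of_ne h,
      if_neg (by simp), zero_add, hk]
    refine c.mul_maxBitValue l _ (c.decode_step_of_ne h x _) ?_
    rw [List.length_append, List.length_singleton]
    omega

theorem maxBitValue_mem_Icc (hl : 0 ≤ l) (hl1 : l ≤ 1) (hγ : 0 ≤ γ) (hγ1 : γ < 1)
    (hW : env.toMDP.IsBellman γ W) (g : History E Bool) :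
    c.maxBitValue l (env.toMDP.qValue γ W) g ∈ Set.Icc 0 (1 - γ)⁻¹ := by
  have hWI := hW.mem_Icc env.unitReward_toMDP hγ hγ1
  have hq : ∀ h a, env.toMDP.qValue γ W h a ∈ Set.Icc 0 (1 - γ)⁻¹ := fun h a =>
    ⟨add_nonneg (env.unitReward_toMDP h a).1 (mul_nonneg hγ (expect_mem_Icc hWI).1),
      (hW.qValue_le h a).trans (hWI h).2⟩
  have hbit : ∀ x, c.bitValue l (env.toMDP.qValue γ W) g x ∈ Set.Icc 0 (1 - γ)⁻¹ := fun x =>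
    c.bestCompletion_mem_Icc hl hl1 (hq _) _ _
  exact ⟨le_max_of_le_left (hbit false).1, max_le (hbit false).2 (hbit true).2⟩

theorem isBellman_maxBitValue (hl : 0 ≤ l) (hl1 : l ≤ 1) (hlγ : l ^ d = γ) (hd : 0 < d)
    (hγ : 0 ≤ γ) (hγ1 : γ < 1) (hW : env.toMDP.IsBellman γ W) :
    (c.binarize filler env).toMDP.IsBellman l (c.maxBitValue l (env.toMDP.qValue γ W)) := by
  have hb : IsBddFun (c.maxBitValue l (env.toMDP.qValue γ W)) :=
    isBddFun_of_mem_Icc (maxBitValue_mem_Icc hl hl1 hγ hγ1 hW)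
  refine ⟨hb, fun g x => ?_, fun g => ?_⟩
  · rw [qValue_binarize hl hlγ hd hW hb]
    cases x
    · exact le_max_left _ _
    · exact le_max_right _ _
  · simp only [qValue_binarize hl hlγ hd hW hb]
    rcases max_choice (c.bitValue l (env.toMDP.qValue γ W) g false)
      (c.bitValue l (env.toMDP.qValue γ W) g true) with h | h
    · exact ⟨false, h⟩
    · exact ⟨true, h⟩

end Binarized

/-! ### Lifting near-optimal bits to near-optimal actions -/

section Lift

variable {E A : Type*} {d : ℕ} (c : BinaryCode A d) (filler : History E Bool → Bool → E)

theorem decode_appendBits {h : History E A} (e : E) (u : List Bool) (g : History E Bool)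
    (w : List Bool) (hg : c.decode g = (h, w)) (hu : u ≠ []) (hd : w.length + u.length = d) :
    c.decode (appendBits filler g u e) = (h.step (c.dec (w ++ u)) e, []) := by
  induction u generalizing g w with
  | nil => exact absurd rfl hu
  | cons x u ih =>
    cases u with
    | nil =>
      rw [appendBits, c.decode_step_of_eq (by rw [hg]; exact hd), hg]
    | cons y u =>
      simp only [List.length_cons] at hd
      rw [appendBits, ih _ (w ++ [x]) _ (by simp)]
      · simp
      · simp only [List.length_append, List.length_cons, List.length_nil]
        omega
      · rw [c.decode_step_of_ne (by rw [hg]; dsimp only; omega), hg]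

theorem decode_encode (hd : 0 < d) (h : History E A) : c.decode (c.encode filler h) = (h, []) := by
  cases h with
  | init e => rfl
  | step h a e =>
    have hl := c.length_enc a
    have ih := decode_encode hd h
    rw [encode, c.decode_appendBits filler e _ _ _ ih, List.nil_append, c.dec_enc]
    · rintro h0
      rw [h0] at hl
      exact hd.ne hl
    · rw [List.length_nil, zero_add, hl]

/-- Sampling `n` bits, each of which loses at most `τ` in value, loses at most `n * τ` compared with
the best completion. -/
theorem bestCompletion_sub_le_expect_sampleBits {l τ : ℝ} (hl : 0 ≤ l) (hl1 : l ≤ 1) (hτ : 0 ≤ τ)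
    {q : History E A → A → ℝ} {h : History E A} (hq : IsBddFun (q h)) {π : Policy E Bool}
    (hπ : ∀ g x, π g x ≠ 0 → c.maxBitValue l q g - τ ≤ c.bitValue l q g x)
    (n : ℕ) (g : History E Bool) (w : List Bool) (hw : w.length + n = d)
    (hg : 0 < n → c.decode g = (h, w)) :
    c.bestCompletion l (q h) n w - n * τ ≤
      l ^ n * expect (sampleBits filler π g n) fun u => q h (c.dec (w ++ u)) := by
  induction n generalizing g w with
  | zero => simp [sampleBits, bestCompletion]
  | succ n ih =>
    have hg' := hg n.succ_pos
    have hb : IsBddFun fun u => q h (c.dec (w ++ u)) := hq.comp _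
    have hbx : IsBddFun fun x => l ^ (n + 1) *
        expect (sampleBits filler π (g.step x (filler g x)) n)
          fun u => q h (c.dec (w ++ x :: u)) := by
      obtain ⟨C, hC⟩ := hq
      exact IsBddFun.const_mul ⟨C, fun x => abs_expect_le fun u => hC _⟩ _
    rw [sampleBits, expect_bind _ _ hb, ← expect_const_mul]
    simp only [expect_map _ _ hb]
    refine le_expect hbx fun x hx => ?_
    have h1 := ih (g.step x (filler g x)) (w ++ [x])
      (by rw [List.length_append, List.length_singleton]; omega)
      (fun hn => by rw [c.decode_step_of_ne (by rw [hg']; dsimp only; omega), hg'])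
    simp only [List.append_assoc, List.singleton_append] at h1
    have h2 := hπ g x hx
    have hk : d - (w.length + 1) = n := by omega
    simp only [bitValue, hg', hk] at h2
    rw [← c.mul_maxBitValue l q hg' hw, pow_succ', mul_assoc]
    have h3 : l * (c.maxBitValue l q g - (n + 1) * τ) ≤ l * (l ^ n *
        expect (sampleBits filler π (g.step x (filler g x)) n)
          fun u => q h (c.dec (w ++ x :: u))) :=
      mul_le_mul_of_nonneg_left (by linarith) hl
    have h4 : l * ((n + 1) * τ) ≤ (n + 1) * τ := mul_le_of_le_one_left (by positivity) hl1
    push_cast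
    linarith

/-- A policy of the binarized environment that loses at most `τ` per bit lifts to a policy of the
original environment that loses at most `d * τ / γ` per action. The factor `1 / γ` appears because
the action is rewarded `d - 1` discounted steps after its first bit. -/
theorem sub_le_expect_liftPolicy {env : Environment E A} {l γ τ : ℝ} (hl : 0 ≤ l) (hl1 : l ≤ 1)
    (hlγ : l ^ d = γ) (hd : 0 < d) (hγ : 0 < γ) (hτ : 0 ≤ τ) {W : History E A → ℝ}
    (hW : env.toMDP.IsBellman γ W) {π : Policy E Bool}
    (hπ : ∀ g x, π g x ≠ 0 → c.maxBitValue l (env.toMDP.qValue γ W) g - τ ≤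
      c.bitValue l (env.toMDP.qValue γ W) g x) (h : History E A) :
    W h - d * τ / γ ≤ expect (c.liftPolicy filler π h) (env.toMDP.qValue γ W h) := by
  have hq := env.unitReward_toMDP.isBddFun_qValue hγ.le hW.isBddFun h
  have h1 := c.bestCompletion_sub_le_expect_sampleBits filler hl hl1 hτ hq hπ d
    (c.encode filler h) [] (by simp) fun _ => c.decode_encode filler hd h
  rw [c.bestCompletion_nil hl (hW.qValue_le h) (hW.exists_eq h), hlγ] at h1
  rw [liftPolicy, expect_map _ _ hq, sub_le_iff_le_add, ← sub_le_iff_le_add',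
    le_div_iff₀ hγ]
  simp only [List.nil_append] at h1
  linarith

end Lift

end BinaryCode

/-! ### The abstraction -/

/-- A map to a finite type has the same fibres as a surjection onto some `Fin S`. -/
theorem exists_surjective_fin_of_fintype {X T : Type*} [Fintype T] (F : X → T) :
    ∃ (S : ℕ) (ψ : X → Fin S), Function.Surjective ψ ∧ S ≤ Fintype.card T ∧
      ∀ x y, ψ x = ψ y → F x = F y := by
  classical
  let e := Fintype.equivFin (Set.range F)
  refine ⟨_, fun x => e (Set.rangeFactorization F x),
    e.surjective.comp Set.rangeFactorization_surjective,
    Fintype.card_le_of_injective _ Subtype.val_injective, fun x y h => ?_⟩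
  exact congrArg Subtype.val (e.injective h)

theorem one_sub_pow_le_mul {l : ℝ} (hl : 0 ≤ l) (n : ℕ) : 1 - l ^ n ≤ n * (1 - l) := by
  have := one_add_mul_le_pow (a := l - 1) (by linarith) n
  rw [add_sub_cancel] at this
  linarith

/-- Classify binarized histories by the cell of their optimal value in a grid of mesh `δ`, an
optimal bit, and whether the other bit is `τ`-optimal. For `τ = ε γ / d` the bits chosen by an
optimal policy of any surrogate lose at most `τ`, if the mesh is `δ = 2 τ (1 - γ) / (5 d)`. -/
theorem exists_abstraction {E A : Type*} [Finite A] [Nonempty A] {d : ℕ} (hd : 0 < d)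
    (env : Environment E A) (c : BinaryCode A d) (filler : History E Bool → Bool → E) {γ ε l : ℝ}
    (hγ : 0 < γ) (hγ1 : γ < 1) (hε : 0 < ε) (hl : 0 ≤ l) (hl1 : l < 1) (hlγ : l ^ d = γ) :
    ∃ (S : ℕ) (ψ : History E Bool → Fin S), Function.Surjective ψ ∧
      (∀ (D : Dispersion ψ) (π : Fin S → PMF Bool),
        (surrogate (c.binarize filler env) ψ D).IsOptimal l π →
        env.IsNearOptimal γ (ε / (1 - γ)) (c.liftPolicy filler fun h => π (ψ h))) ∧
      (S : ℝ) ≤ 10 * d ^ 2 / (γ * ε * (1 - γ) ^ 2) + 4 := by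
  have hd' : (0 : ℝ) < d := Nat.cast_pos.2 hd
  have hγ' : 0 < 1 - γ := sub_pos.2 hγ1
  have hl' : 0 < 1 - l := sub_pos.2 hl1
  obtain ⟨W, hW⟩ := env.unitReward_toMDP.exists_isBellman hγ.le hγ1
  set τ := ε * γ / d
  have hτ : 0 < τ := by positivity
  set δ := 2 * τ * (1 - γ) / (5 * d)
  have hδ : 0 < δ := by positivity
  have hU := c.isBellman_maxBitValue (filler := filler) hl hl1.le hlγ hd hγ.le hγ1 hW
  have hUI := c.maxBitValue_mem_Icc hl hl1.le hγ.le hγ1 hW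
  have hbit := fun g x => c.qValue_binarize (filler := filler) hl hlγ hd hW hU.isBddFun g x
  set Q := c.bitValue l (env.toMDP.qValue γ W)
  set U := c.maxBitValue l (env.toMDP.qValue γ W)
  choose b hb using hU.exists_eq
  simp only [hbit] at hb
  set N := ⌊(1 - γ)⁻¹ / δ⌋₊
  have hcell : ∀ g, ⌊U g / δ⌋₊ < N + 1 := fun g =>
    Nat.lt_succ_of_le (Nat.floor_le_floor (div_le_div_of_nonneg_right (hUI g).2 hδ.le))
  classical
  obtain ⟨S, ψ, hψ, hS, hF⟩ := exists_surjective_fin_of_fintype fun g =>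
    ((⟨⌊U g / δ⌋₊, hcell g⟩ : Fin (N + 1)), b g, decide (U g - τ ≤ Q g (!b g)))
  simp only [Prod.mk.injEq, Fin.mk.injEq, decide_eq_decide] at hF
  refine ⟨S, ψ, hψ, fun D π hπ => ?_, ?_⟩
  · have hε' : ε = d * τ / γ := by
      simp only [τ]
      field_simp
    choose r hr using hψ
    have hcl : ∀ g, b (r (ψ g)) = b g := fun g => (hF _ _ (hr (ψ g))).2.1
    rw [hε']
    refine env.isNearOptimal_of_defect_le hγ.le hγ1 hW fun h =>
      c.sub_le_expect_liftPolicy filler hl hl1.le hlγ hd hγ hτ.le hW (fun g x hx => ?_) h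
    change U g - τ ≤ Q g x
    rw [← hbit]
    refine le_qValue_of_isOptimal_surrogate D (δ := δ) (β := fun s => b (r s)) hl hl1 hU
      (fun g g' h => ?_) (fun g => ?_) (fun g g' x h hx => ?_) ?_ hπ g hx
    · -- values in the same cell differ by less than the mesh
      have h1 := (hF g g' h).1
      have h2 := Nat.floor_le (div_nonneg (hUI g).1 hδ.le)
      have h3 := Nat.lt_floor_add_one (U g / δ)
      have h4 := Nat.floor_le (div_nonneg (hUI g').1 hδ.le)
      have h5 := Nat.lt_floor_add_one (U g' / δ)
      rw [h1] at h2 h3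
      have h6 : |U g / δ - U g' / δ| ≤ 1 := abs_le.2 ⟨by linarith, by linarith⟩
      rwa [← sub_div, abs_div, abs_of_pos hδ, div_le_one hδ] at h6
    · rw [hbit, hcl, ← hb]
    · rw [hbit] at hx ⊢
      obtain ⟨-, h2, h3⟩ := hF g g' h
      by_cases hxb : x = b g'
      · rw [hxb, ← hb]
        linarith
      · obtain rfl : x = !b g' := Bool.eq_not.2 hxb
        rw [← h2] at hx ⊢
        rw [← h2] at h3
        exact h3.1 hx
    · -- by Bernoulli's inequality `1 - γ ≤ d (1 - l)`
      have hbern := one_sub_pow_le_mul hl d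
      rw [hlγ] at hbern
      rw [div_lt_iff₀ hl', show 2 * δ = τ * (4 * (1 - γ) / (5 * d)) by simp only [δ]; ring]
      refine mul_lt_mul_of_pos_left ?_ hτ
      rw [div_lt_iff₀ (by positivity)]
      nlinarith
  · have hN : (N : ℝ) ≤ (1 - γ)⁻¹ / δ := Nat.floor_le (by positivity)
    have hS' : (S : ℝ) ≤ (N + 1) * 4 := by
      refine (Nat.cast_le.2 hS).trans ?_
      simp only [Fintype.card_prod, Fintype.card_fin, Fintype.card_bool]
      push_cast
      linarith
    have hval : (1 - γ)⁻¹ / δ * 4 = 10 * d ^ 2 / (γ * ε * (1 - γ) ^ 2) := by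
      simp only [δ, τ]
      field_simp
      norm_num
    linarith

end

/-! ### The bounds on the number of states -/

theorem mainTheorem3 :
    ∃ A₀ : ℕ, ∀ (E : Type*) (A : Type*) [Countable E] [Fintype A] (env : Environment E A)
      (c : BinaryCode A (Nat.clog 2 (Fintype.card A))) (filler : History E Bool → Bool → E)
      (γ ε : ℝ), 2 ≤ Fintype.card A → 0 < γ → γ < 1 → 0 < ε →
      ∃ (S : ℕ) (ψ : History E Bool → Fin S), Function.Surjective ψ ∧
        (∀ (D : Dispersion ψ) (π : Fin S → PMF Bool),
          (surrogate (c.binarize filler env) ψ D).IsOptimal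
            (γ ^ (1 / (Nat.clog 2 (Fintype.card A) : ℝ))) π →
          env.IsNearOptimal γ (ε / (1 - γ)) (c.liftPolicy filler fun h => π (ψ h))) ∧
        (S : ℝ) ≤ max 1
          (16 * ((Nat.clog 2 (Fintype.card A) : ℝ) + 1 - γ) ^ 3 / (γ * ε * (1 - γ) ^ 2)) ∧
        (0.99 ≤ γ ∨ (A₀ ≤ Fintype.card A ∧ 0.95 ≤ γ) →
          (S : ℝ) ≤ max 1
            (17 * (Nat.clog 2 (Fintype.card A) : ℝ) ^ 3 * ε⁻¹ * ((1 - γ) ^ 2)⁻¹)) := by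
  refine ⟨0, fun E A _ _ env c filler γ ε hA hγ hγ1 hε => ?_⟩
  have hd : 0 < Nat.clog 2 (Fintype.card A) := Nat.clog_pos (by norm_num) hA
  have : Nonempty A := Fintype.card_pos_iff.1 (by omega)
  have hγ' : 0 < 1 - γ := sub_pos.2 hγ1
  revert c hd
  generalize Nat.clog 2 (Fintype.card A) = d
  intro c hd
  have hd1 : (1 : ℝ) ≤ d := Nat.one_le_cast.2 hd
  rcases le_or_gt 1 ε with hε1 | hε1
  · obtain ⟨e, -⟩ := env.initial.support_nonempty
    refine ⟨1, fun _ => 0, fun s => ⟨.init e, Subsingleton.elim _ _⟩,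
      fun D π _ => env.isNearOptimal_of_one_le hγ.le hγ1 hε1 _, ?_, fun _ => ?_⟩ <;>
    · rw [Nat.cast_one]
      exact le_max_left _ _
  · -- For `ε < 1` the constant term `4` is absorbed, as both denominators are at most `1`.
    have hdinv : (0 : ℝ) < 1 / d := by positivity
    obtain ⟨S, ψ, hψ, hopt, hS⟩ := exists_abstraction hd env c filler hγ hγ1 hε
      (Real.rpow_nonneg hγ.le (1 / (d : ℝ))) (Real.rpow_lt_one hγ.le hγ1 hdinv)
      (by rw [one_div, Real.rpow_inv_natCast_pow hγ.le hd.ne'])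
    refine ⟨S, ψ, hψ, hopt, le_max_of_le_right (hS.trans ?_),
      fun h => le_max_of_le_right (hS.trans ?_)⟩
    · have hX : 0 < γ * ε * (1 - γ) ^ 2 := by positivity
      have hX1 : γ * ε * (1 - γ) ^ 2 ≤ 1 :=
        mul_le_one₀ (mul_le_one₀ hγ1.le hε.le hε1.le) (by positivity)
          (pow_le_one₀ hγ'.le (by linarith))
      rw [div_add' _ _ _ hX.ne']
      refine div_le_div_of_nonneg_right ?_ hX.le
      have h1 : (d : ℝ) ^ 3 ≤ (d + 1 - γ) ^ 3 := by gcongr; linarith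
      have h2 : (d : ℝ) ^ 2 ≤ d ^ 3 := pow_le_pow_right₀ hd1 (by norm_num)
      have h3 : (1 : ℝ) ≤ d ^ 3 := one_le_pow₀ hd1
      linarith
    · have hγ2 : 0.95 ≤ γ := by
        rcases h with h | h
        · exact le_trans (by norm_num) h
        · exact h.2
      have hX : 0 < ε * (1 - γ) ^ 2 := by positivity
      have hX1 : ε * (1 - γ) ^ 2 ≤ 1 :=
        mul_le_one₀ hε1.le (by positivity) (pow_le_one₀ hγ'.le (by linarith))
      have h2 : (d : ℝ) ^ 2 ≤ d ^ 3 := pow_le_pow_right₀ hd1 (by norm_num)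
      have h3 : (1 : ℝ) ≤ d ^ 3 := one_le_pow₀ hd1
      rw [mul_assoc (17 * (d : ℝ) ^ 3), ← mul_inv, ← div_eq_mul_inv, mul_assoc γ,
        mul_comm γ, ← div_div, div_div, le_div_iff₀ hX, add_mul]
      have h4 : 10 * (d : ℝ) ^ 2 / (ε * (1 - γ) ^ 2 * γ) * (ε * (1 - γ) ^ 2) =
          10 * d ^ 2 / γ := by field_simp
      have h5 : 10 * (d : ℝ) ^ 2 / γ ≤ 12 * d ^ 2 := by
        rw [div_le_iff₀ hγ]
        nlinarith [sq_nonneg (d : ℝ)]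
      rw [h4]
      linarith
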